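/- An instance of size $n$ consists of disjoint sets $A,B$ with $|A|=|B|=n$, a known strict total order $\prec_a$ of $B$ for each $a\in A$, and an unknown strict total order $\prec_b$ of $A$ for each $b\in B$ (smaller means more preferred). A matching is a bijection $M$ between $A$ and $B$; it is stable if there is no pair $(a,b)\in A\times B$ with $M(a)\neq b$, $b\prec_a M(a)$ and $a\prec_b M(b)$. A stable matching is $B$-optimal if no $b\in B$ prefers its partner in another stable matching to its partner in it. An interview query $\mathit{intq}(b,a)$ with $b\in B$, $a\in A$ reveals the restriction of $\prec_b$ to $\{a\}\cup P_b$, where $P_b$ is the set of all $a'\in A$ for which $\mathit{intq}(b,a')$ has been executed before. A deterministic online algorithm knows the orders $\prec_a$, $a\in A$, makes interview queries adaptively, and outputs a matching that must be the $B$-optimal stable matching whatever the orders $\prec_b$ are (so the answers it has received prove its output correct). A randomized online algorithm is, for each family of $A$-side orders, a probability distribution over such deterministic strategies. For an instance $I$ with actual orders $\prec_b$, let $\mathrm{OPT}(I)$ be the minimum length of a sequence of interview queries whose answers on $I$ prove that some matching is the $B$-optimal stable matching, i.e. this matching is the $B$-optimal stable matching for all $B$-side orders that give the same answers. An algorithm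 is $\rho$-competitive on instances of size $n$ if its (expected) number of queries on every such instance $I$ is at most $\rho\cdot\mathrm{OPT}(I)$. Let $\rho_{\mathrm{rand}}(n)$ and $\rho_{\mathrm{det}}(n)$ be the infima of all $\rho\ge 0$ for which some randomized, respectively deterministic, online algorithm is $\rho$-competitive on instances of size $n$. Theorem. $\rho_{\mathrm{rand}}(n)$ and $\rho_{\mathrm{det}}(n)$ are finite for every $n$, and $\rho_{\mathrm{rand}}(n)=\Theta(n)$ and $\rho_{\mathrm{det}}(n)=\Theta(n)$ as $n\to\infty$. That is, the best possible competitive ratio for finding the $B$-optimal stable matching with interview queries is $\Theta(n)$, both for deterministic and for randomized algorithms. -/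

import Mathlib

open scoped NNReal ENNReal

namespace Interview

/-- A preference list over `n` agents, i.e. a strict total order, encoded by its rank bijection:
`r x` is the position of agent `x` on the list (position `0` is the most preferred). -/
abbrev Pref (n : ℕ) := Equiv.Perm (Fin n)

/-- Under the preference list `r`, agent `x` is preferred to agent `y`. -/
abbrev Prefers {n : ℕ} (r : Pref n) (x y : Fin n) : Prop := r x < r y

/-- The preference lists of all agents of one side. Both sides `A` and `B` are labelled by
`Fin n`. An `A`-side profile maps each `a` to its list of the agents of `B`, and a `B`-side
profile maps each `b` to its list of the agents of `A`. -/
abbrev Profile (n : ℕ) := Fin n → Pref n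

/-- A matching is a bijection `M` from `A` to `B`; the partner of `b` is `M.symm b`. -/
abbrev Matching (n : ℕ) := Fin n ≃ Fin n

/-- `(a, b)` is a blocking pair of `M`. -/
def IsBlockingPair {n : ℕ} (PA PB : Profile n) (M : Matching n) (a b : Fin n) : Prop :=
  M a ≠ b ∧ Prefers (PA a) b (M a) ∧ Prefers (PB b) a (M.symm b)

/-- `M` has no blocking pair. -/
def IsStable {n : ℕ} (PA PB : Profile n) (M : Matching n) : Prop :=
  ∀ a b, ¬ IsBlockingPair PA PB M a b

/-- `M` is a stable matching such that no agent of `B` prefers its partner in another stable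
matching to its partner in `M`. -/
def IsBOptimal {n : ℕ} (PA PB : Profile n) (M : Matching n) : Prop :=
  IsStable PA PB M ∧
    ∀ M' : Matching n, IsStable PA PB M' → ∀ b, ¬ Prefers (PB b) (M'.symm b) (M.symm b)

/-- The set `P_b` of agents of `A` that `b` has interviewed, where `asked` is the set of pairs
`(b', a')` whose interview has been executed so far. -/
def interviewed {n : ℕ} (asked : Finset (Fin n × Fin n)) (b : Fin n) : Finset (Fin n) :=
  Finset.univ.filter fun a => (b, a) ∈ asked

/-- The answer to the interview query of `b` with `a`, when the interviews in `asked` have been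
executed before: the total order induced by the list of `b` on `{a} ∪ P_b`, given as the set of
all pairs `(x, y)` of elements of `{a} ∪ P_b` such that `b` prefers `x` to `y`. -/
def intq {n : ℕ} (PB : Profile n) (asked : Finset (Fin n × Fin n)) (b a : Fin n) :
    Finset (Fin n × Fin n) :=
  (insert a (interviewed asked b) ×ˢ insert a (interviewed asked b)).filter
    fun p => Prefers (PB b) p.1 p.2

/-- A deterministic adaptive query strategy: it either stops with a matching, or executes the
interview of `b` with `a` and continues depending on the answer. -/
inductive Strategy (n : ℕ) : Type
  | output (M : Matching n) : Strategy n
  | query (b a : Fin n) (next : Finset (Fin n × Fin n) → Strategy n) : Strategy n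

/-- The matching that the strategy outputs when the true `B`-side profile is `PB` and the
interviews in `asked` have already been executed. -/
def Strategy.result {n : ℕ} (PB : Profile n) : Strategy n → Finset (Fin n × Fin n) → Matching n
  | .output M, _ => M
  | .query b a next, asked => (next (intq PB asked b a)).result PB (insert (b, a) asked)

/-- The number of interviews that the strategy executes when the true `B`-side profile is `PB`
and the interviews in `asked` have already been executed. -/
def Strategy.cost {n : ℕ} (PB : Profile n) : Strategy n → Finset (Fin n × Fin n) → ℕ
  | .output _, _ => 0
  | .query b a next, asked => (next (intq PB asked b a)).cost PB (insert (b, a) asked) + 1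

/-- The strategy finds the `B`-optimal stable matching for the known `A`-side profile `PA`,
whatever the unknown `B`-side profile is. Equivalently, whenever the strategy stops, the answers
obtained prove that its output is the `B`-optimal stable matching. -/
def Strategy.FindsBOptimal {n : ℕ} (PA : Profile n) (S : Strategy n) : Prop :=
  ∀ PB : Profile n, IsBOptimal PA PB (S.result PB ∅)

/-- The answers to a list of interviews executed one after the other. -/
def transcript {n : ℕ} (PB : Profile n) :
    List (Fin n × Fin n) → Finset (Fin n × Fin n) → List (Finset (Fin n × Fin n))
  | [], _ => []
  | q :: qs, asked => intq PB asked q.1 q.2 :: transcript PB qs (insert q asked)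

/-- The answers to the interviews `qs`, when the true `B`-side profile is `PB`, prove that some
matching `M` is the `B`-optimal stable matching: it is for every `B`-side profile that yields
the same answers. -/
def Proves {n : ℕ} (PA PB : Profile n) (qs : List (Fin n × Fin n)) : Prop :=
  ∃ M : Matching n, ∀ PB' : Profile n,
    transcript PB' qs ∅ = transcript PB qs ∅ → IsBOptimal PA PB' M

/-- `OPT`: the minimum number of interviews whose answers allow one to output a provably correct
`B`-optimal stable matching for the instance. -/
noncomputable def opt {n : ℕ} (PA PB : Profile n) : ℕ :=
  sInf {k | ∃ qs : List (Fin n × Fin n), qs.length = k ∧ Proves PA PB qs}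

/-- A deterministic online algorithm for instances of size `n`: knowing the `A`-side profile,
it chooses a strategy. -/
abbrev DetAlg (n : ℕ) := Profile n → Strategy n

/-- A randomized online algorithm for instances of size `n`: a probability distribution over
deterministic strategies, depending on the known `A`-side profile. -/
abbrev RandAlg (n : ℕ) := Profile n → PMF (Strategy n)

/-- The expected number of interviews executed on the instance `(PA, PB)`. -/
noncomputable def RandAlg.expectedCost {n : ℕ} (R : RandAlg n) (PA PB : Profile n) : ℝ≥0∞ :=
  ∑' S : Strategy n, R PA S * (S.cost PB ∅ : ℝ≥0∞)

/-- The deterministic algorithm `D` finds the `B`-optimal stable matching and is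
`ρ`-competitive on instances of size `n`. -/
def DetAlg.IsCompetitive {n : ℕ} (D : DetAlg n) (ρ : ℝ≥0) : Prop :=
  (∀ PA, (D PA).FindsBOptimal PA) ∧
    ∀ PA PB : Profile n, ((D PA).cost PB ∅ : ℝ≥0) ≤ ρ * (opt PA PB : ℝ≥0)

/-- The randomized algorithm `R` finds the `B`-optimal stable matching (with every outcome of its
random choices) and is `ρ`-competitive in expectation on instances of size `n`. -/
def RandAlg.IsCompetitive {n : ℕ} (R : RandAlg n) (ρ : ℝ≥0) : Prop :=
  (∀ PA, ∀ S ∈ (R PA).support, S.FindsBOptimal PA) ∧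
    ∀ PA PB : Profile n, R.expectedCost PA PB ≤ (ρ : ℝ≥0∞) * (opt PA PB : ℝ≥0∞)

/-- The best possible competitive ratio of deterministic algorithms on instances of size `n`
(`⊤` if there is no competitive algorithm). -/
noncomputable def bestDetRatio (n : ℕ) : ℝ≥0∞ :=
  ⨅ (ρ : ℝ≥0) (_ : ∃ D : DetAlg n, D.IsCompetitive ρ), (ρ : ℝ≥0∞)

/-- The best possible competitive ratio of randomized algorithms on instances of size `n`
(`⊤` if there is no competitive algorithm). -/
noncomputable def bestRandRatio (n : ℕ) : ℝ≥0∞ :=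
  ⨅ (ρ : ℝ≥0) (_ : ∃ R : RandAlg n, R.IsCompetitive ρ), (ρ : ℝ≥0∞)

end Interview

/-! Upper bound: executing all `n * n` interviews determines the answer, since a `B`-optimal stable
matching exists (deferred acceptance). Conversely every proof of optimality needs about `n / 2`
interviews: if two agents of `B` and both their partners under the output occur in no interview, the
`B`-side may be such that these two gain by exchanging partners without creating a blocking pair
(`exists_swap_of_untouched`). Hence the ratio is at most `4 * n`.

Lower bound, by averaging over a random family of instances (Yao's principle). In the hard instances
every agent of `A` ranks its counterpart first, and searcher `i` is liked by a single hub `f i`,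
with `f` uniform. Hub `f i` is the only obstacle to searcher `i` and its companion exchanging
partners, an exchange that their counterparts in `B` desire. So the identity is the only stable
matching, but with `f i` removed it is no longer `B`-optimal, and a correct strategy must interview
the pair (hub `f i`, searcher `i`) (`hubQuery_mem_executed`). Someone who knows `f` proves the
identity optimal with `3 * n` interviews (`opt_hard_le`). A strategy that does not know `f` has to
search among `k + 1` indistinguishable hubs for each of the `m` searchers, which takes `m * (k + 2)
/ 2` interviews on average (`sum_cost_ge`). With `m` and `k` both about `n / 3`, the ratio is linear
in `n`. -/

namespace Interview

variable {n : ℕ}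

/-! ### Existence of the `B`-optimal stable matching -/

/-- The invariant of deferred acceptance with proposals by `B`, where `t b` is the agent to whom
`b` is currently proposing. -/
def IsProposalState (PA PB : Profile n) (t : Fin n → Fin n) : Prop :=
  (∀ b a, Prefers (PB b) a (t b) → ∃ b', t b' = a ∧ Prefers (PA a) b' b) ∧
    ∀ M : Matching n, IsStable PA PB M → ∀ b, ¬ Prefers (PB b) (M.symm b) (t b)

theorem exists_next_preferred (r : Pref n) (x : Fin n) (h : ∃ z, r x < r z) :
    ∃ y, r x < r y ∧ ∀ z, r z < r y → z = x ∨ r z < r x := by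
  obtain ⟨z, hz⟩ := h
  have hlt : (r x : ℕ) + 1 < n := lt_of_le_of_lt (Nat.succ_le_of_lt hz) (r z).isLt
  refine ⟨r.symm ⟨r x + 1, hlt⟩, ?_, ?_⟩
  · simp [Fin.lt_def]
  · intro w hw
    simp only [Equiv.apply_symm_apply, Fin.lt_def] at hw
    rcases Nat.lt_succ_iff_lt_or_eq.mp hw with h | h
    · exact Or.inr h
    · exact Or.inl (r.injective (Fin.ext h))

/-- One rejection: `b₁` and `b₂` propose to the same agent, who rejects `b₂`, and `b₂` moves on to
the next agent on its list. -/
theorem IsProposalState.exists_update {PA PB : Profile n} {t : Fin n → Fin n}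
    (ht : IsProposalState PA PB t) {b₁ b₂ : Fin n} (heq : t b₁ = t b₂)
    (hlt : Prefers (PA (t b₂)) b₁ b₂) :
    ∃ a, Prefers (PB b₂) (t b₂) a ∧ IsProposalState PA PB (Function.update t b₂ a) := by
  have hne : b₁ ≠ b₂ := by rintro rfl; exact lt_irrefl _ hlt
  -- If `b₂` were at the end of its list, every agent of `A` would hold a proposal, so `t` would be
  -- a bijection and there would be no conflict.
  have hex : ∃ z, PB b₂ (t b₂) < PB b₂ z := by
    by_contra! hlast
    have hsurj : Function.Surjective t := by
      intro a
      by_cases ha : a = t b₂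
      · exact ⟨b₂, ha.symm⟩
      · obtain ⟨b', hb', -⟩ := ht.1 b₂ a
          (lt_of_le_of_ne (hlast a) fun h => ha ((PB b₂).injective h))
        exact ⟨b', hb'⟩
    exact hne (Finite.injective_iff_surjective.mpr hsurj heq)
  obtain ⟨a, hta, ha⟩ := exists_next_preferred (PB b₂) (t b₂) hex
  have key : ∀ b c, Prefers (PB b) c (Function.update t b₂ a b) →
      (b = b₂ ∧ c = t b₂) ∨ Prefers (PB b) c (t b) := by
    intro b c h
    by_cases hb : b = b₂
    · subst hb
      rw [Function.update_self] at h
      rcases ha c h with h | h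
      · exact Or.inl ⟨rfl, h⟩
      · exact Or.inr h
    · rw [Function.update_of_ne hb] at h
      exact Or.inr h
  refine ⟨a, hta, ?_, ?_⟩
  · intro b c h
    rcases key b c h with ⟨rfl, rfl⟩ | h
    · exact ⟨b₁, by rw [Function.update_of_ne hne, heq], hlt⟩
    · obtain ⟨b', rfl, hb'⟩ := ht.1 b c h
      by_cases hb : b' = b₂
      · subst hb
        exact ⟨b₁, by rw [Function.update_of_ne hne, heq], lt_trans hlt hb'⟩
      · exact ⟨b', Function.update_of_ne hb _ _, hb'⟩
  · intro M hM b h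
    rcases key b _ h with ⟨rfl, h⟩ | h
    -- A stable matching cannot contain the rejected pair: `b₁` can get nothing better than `t b` in
    -- it, so `b₁` and `t b` would block.
    · have hMa : M (t b) = b := by rw [← h, Equiv.apply_symm_apply]
      refine hM (t b) b₁ ⟨by rw [hMa]; exact hne.symm, by rw [hMa]; exact hlt, ?_⟩
      refine lt_of_le_of_ne (heq ▸ not_lt.mp (ht.2 M hM b₁)) fun h' => hne ?_
      have := (PB b₁).injective h'
      rw [this, Equiv.apply_symm_apply] at hMa
      exact hMa
    · exact ht.2 M hM b h

theorem IsProposalState.isBOptimal {PA PB : Profile n} {t : Fin n → Fin n}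
    (ht : IsProposalState PA PB t) (hinj : Function.Injective t) :
    IsBOptimal PA PB (Equiv.ofBijective t (Finite.injective_iff_bijective.mp hinj)).symm := by
  refine ⟨?_, fun M hM b => by simpa using ht.2 M hM b⟩
  rintro a b ⟨-, h₁, h₂⟩
  obtain ⟨b', rfl, hb'⟩ := ht.1 b a (by simpa using h₂)
  have : (Equiv.ofBijective t (Finite.injective_iff_bijective.mp hinj)).symm (t b') = b' :=
    Equiv.ofBijective_symm_apply_apply t _ b'
  rw [this] at h₁
  exact lt_asymm h₁ hb'

/-- A rejection increases the sum of the ranks of the current proposals, so a proposal state that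
maximizes this sum has no conflict left and is a matching. -/
theorem exists_isBOptimal (PA PB : Profile n) : ∃ M, IsBOptimal PA PB M := by
  have hne : {t | IsProposalState PA PB t}.Nonempty := by
    rcases Nat.eq_zero_or_pos n with rfl | hn
    · exact ⟨id, fun b => b.elim0, fun _ _ b => b.elim0⟩
    · have : NeZero n := ⟨hn.ne'⟩
      refine ⟨fun b => (PB b).symm 0, fun b a h => ?_, fun M _ b h => ?_⟩ <;>
      · simp only [Prefers, Equiv.apply_symm_apply] at h
        exact absurd h (Fin.not_lt_zero _)
  obtain ⟨t, ht, hmax⟩ := Set.exists_max_image {t | IsProposalState PA PB t}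
    (fun t => ∑ b, (PB b (t b) : ℕ)) (Set.toFinite _) hne
  have step : ∀ b₁ b₂, t b₁ = t b₂ → ¬ Prefers (PA (t b₂)) b₁ b₂ := by
    intro b₁ b₂ heq hlt
    obtain ⟨a, ha, hst⟩ := IsProposalState.exists_update ht heq hlt
    refine absurd (hmax _ hst) (not_le.mpr (Finset.sum_lt_sum (fun b _ => ?_)
      ⟨b₂, Finset.mem_univ _, by simpa using ha⟩))
    by_cases hb : b = b₂
    · subst hb
      simpa using ha.le
    · rw [Function.update_of_ne hb]
  refine ⟨_, IsProposalState.isBOptimal ht fun b₁ b₂ heq => ?_⟩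
  by_contra hne
  rcases lt_or_gt_of_ne fun h => hne ((PA (t b₂)).injective h) with h | h
  · exact step b₁ b₂ heq h
  · exact step b₂ b₁ heq.symm (heq ▸ h)

/-! ### Profiles that cannot be told apart by interviews -/

/-- The two `B`-side profiles agree on the pairs in `asked`. -/
def Agree (PB PB' : Profile n) (asked : Finset (Fin n × Fin n)) : Prop :=
  ∀ b x y, (b, x) ∈ asked → (b, y) ∈ asked →
    (Prefers (PB b) x y ↔ Prefers (PB' b) x y)

theorem Agree.mono {PB PB' : Profile n} {s t : Finset (Fin n × Fin n)}
    (h : Agree PB PB' t) (hst : s ⊆ t) : Agree PB PB' s :=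
  fun b x y hx hy => h b x y (hst hx) (hst hy)

theorem mem_insert_interviewed {asked : Finset (Fin n × Fin n)} {b a x : Fin n} :
    x ∈ insert a (interviewed asked b) ↔ (b, x) ∈ insert (b, a) asked := by
  simp [interviewed]

theorem intq_congr {PB PB' : Profile n} {asked : Finset (Fin n × Fin n)} {b a : Fin n}
    (h : ∀ x y, (b, x) ∈ insert (b, a) asked → (b, y) ∈ insert (b, a) asked →
      (Prefers (PB b) x y ↔ Prefers (PB' b) x y)) :
    intq PB asked b a = intq PB' asked b a := by
  unfold intq
  refine Finset.filter_congr fun p hp => ?_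
  rw [Finset.mem_product] at hp
  exact h _ _ (mem_insert_interviewed.mp hp.1) (mem_insert_interviewed.mp hp.2)

theorem Agree.insert_of_intq {PB PB' : Profile n} {asked : Finset (Fin n × Fin n)} {b a : Fin n}
    (h : Agree PB PB' asked) (hq : intq PB asked b a = intq PB' asked b a) :
    Agree PB PB' (insert (b, a) asked) := by
  intro b' x y hx hy
  by_cases hb : b' = b
  · subst hb
    have := Finset.ext_iff.mp hq (x, y)
    simpa [intq, Finset.mem_filter, -Finset.mem_insert, mem_insert_interviewed, hx, hy] using this
  · simp only [Finset.mem_insert, Prod.mk.injEq, hb, false_and, false_or] at hx hy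
    exact h b' x y hx hy

theorem transcript_congr {PB PB' : Profile n} (qs : List (Fin n × Fin n))
    (asked : Finset (Fin n × Fin n)) (h : Agree PB PB' (asked ∪ qs.toFinset)) :
    transcript PB qs asked = transcript PB' qs asked := by
  induction qs generalizing asked with
  | nil => rfl
  | cons q qs ih =>
    have hset : insert q asked ∪ qs.toFinset = asked ∪ (q :: qs).toFinset := by
      ext z; simp
    have h' : Agree PB PB' (insert q asked) :=
      h.mono (hset ▸ Finset.subset_union_left)
    simp only [transcript]
    rw [ih _ (hset ▸ h), intq_congr fun x y hx hy => h' _ x y hx hy]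

theorem agree_of_transcript_eq {PB PB' : Profile n} (qs : List (Fin n × Fin n))
    (asked : Finset (Fin n × Fin n)) (h : Agree PB PB' asked)
    (ht : transcript PB qs asked = transcript PB' qs asked) :
    Agree PB PB' (asked ∪ qs.toFinset) := by
  induction qs generalizing asked with
  | nil => simpa using h
  | cons q qs ih =>
    have hset : insert q asked ∪ qs.toFinset = asked ∪ (q :: qs).toFinset := by
      ext z; simp
    simp only [transcript, List.cons.injEq] at ht
    exact hset ▸ ih _ (h.insert_of_intq ht.1) ht.2

theorem transcript_eq_iff {PB PB' : Profile n} (qs : List (Fin n × Fin n)) :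
    transcript PB qs ∅ = transcript PB' qs ∅ ↔ Agree PB PB' qs.toFinset := by
  constructor
  · intro h
    simpa using agree_of_transcript_eq qs ∅ (fun _ _ _ hx => absurd hx (Finset.notMem_empty _)) h
  · intro h
    exact transcript_congr qs ∅ (by simpa using h)

theorem Agree.isBOptimal_iff {PB PB' : Profile n} (h : Agree PB PB' Finset.univ) (PA : Profile n)
    (M : Matching n) : IsBOptimal PA PB M ↔ IsBOptimal PA PB' M := by
  have h' : ∀ b x y, PB b x < PB b y ↔ PB' b x < PB' b y :=
    fun b x y => h b x y (Finset.mem_univ _) (Finset.mem_univ _)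
  simp only [IsBOptimal, IsStable, IsBlockingPair, Prefers, h']

/-! ### Executing all interviews -/

theorem proves_univ (PA PB : Profile n) :
    Proves PA PB (Finset.univ : Finset (Fin n × Fin n)).toList := by
  obtain ⟨M, hM⟩ := exists_isBOptimal PA PB
  refine ⟨M, fun PB' h => ?_⟩
  rw [transcript_eq_iff, Finset.toList_toFinset] at h
  exact (h.isBOptimal_iff PA M).mpr hM

/-- The strategy that executes the interviews `qs` and outputs `k` of the answers. -/
def Strategy.ofList : List (Fin n × Fin n) → (List (Finset (Fin n × Fin n)) → Matching n) →
    Strategy n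
  | [], k => .output (k [])
  | q :: qs, k => .query q.1 q.2 fun ans => Strategy.ofList qs fun l => k (ans :: l)

theorem Strategy.result_ofList (PB : Profile n) (qs : List (Fin n × Fin n))
    (k : List (Finset (Fin n × Fin n)) → Matching n) (asked : Finset (Fin n × Fin n)) :
    (Strategy.ofList qs k).result PB asked = k (transcript PB qs asked) := by
  induction qs generalizing k asked with
  | nil => rfl
  | cons q qs ih => simp [Strategy.ofList, Strategy.result, transcript, ih]

theorem Strategy.cost_ofList (PB : Profile n) (qs : List (Fin n × Fin n))
    (k : List (Finset (Fin n × Fin n)) → Matching n) (asked : Finset (Fin n × Fin n)) :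
    (Strategy.ofList qs k).cost PB asked = qs.length := by
  induction qs generalizing k asked with
  | nil => rfl
  | cons q qs ih => simp [Strategy.ofList, Strategy.cost, ih]

theorem exists_findsBOptimal (PA : Profile n) :
    ∃ S : Strategy n, S.FindsBOptimal PA ∧ ∀ PB, S.cost PB ∅ = n * n := by
  classical
  have hk : ∀ ts : List (Finset (Fin n × Fin n)), ∃ M : Matching n, ∀ PB,
      transcript PB (Finset.univ : Finset (Fin n × Fin n)).toList ∅ = ts →
        IsBOptimal PA PB M := by
    intro ts
    by_cases h : ∃ PB, transcript PB (Finset.univ : Finset (Fin n × Fin n)).toList ∅ = ts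
    · obtain ⟨PB, rfl⟩ := h
      exact proves_univ PA PB
    -- No profile yields these answers, so any matching serves.
    · exact ⟨1, fun PB hPB => absurd ⟨PB, hPB⟩ h⟩
  choose k hk using hk
  refine ⟨Strategy.ofList Finset.univ.toList k, fun PB => ?_, fun PB => ?_⟩
  · rw [Strategy.result_ofList]
    exact hk _ PB rfl
  · simp [Strategy.cost_ofList]

theorem exists_proves_length_eq_opt (PA PB : Profile n) :
    ∃ qs, qs.length = opt PA PB ∧ Proves PA PB qs :=
  Nat.sInf_mem (s := {k | ∃ qs : List (Fin n × Fin n), qs.length = k ∧ Proves PA PB qs})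
    ⟨_, _, rfl, proves_univ PA PB⟩

theorem opt_le_length {PA PB : Profile n} {qs : List (Fin n × Fin n)} (h : Proves PA PB qs) :
    opt PA PB ≤ qs.length :=
  Nat.sInf_le ⟨qs, rfl, h⟩

/-! ### Preference lists from keys -/

theorem exists_pref_of_key (f : Fin n → ℕ) (tie : Pref n) :
    ∃ r : Pref n, ∀ x y, r x < r y ↔ f x < f y ∨ f x = f y ∧ tie x < tie y := by
  let k : Fin n → ℕ ×ₗ Fin n := fun x => toLex (f x, tie x)
  have hk : Function.Injective k := by
    intro x y h
    have h2 := congrArg (fun z => (ofLex z).2) h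
    exact tie.injective h2
  have hmono : StrictMono (k ∘ Tuple.sort k) :=
    (Tuple.monotone_sort k).strictMono_of_injective (hk.comp (Tuple.sort k).injective)
  refine ⟨(Tuple.sort k).symm, fun x y => ?_⟩
  rw [← hmono.lt_iff_lt]
  simp only [Function.comp, Equiv.apply_symm_apply]
  exact Prod.Lex.lt_iff

/-- The preference list that sorts by the key `f` and breaks ties according to `tie`. -/
noncomputable def prefOfKey (f : Fin n → ℕ) (tie : Pref n) : Pref n :=
  (exists_pref_of_key f tie).choose

theorem prefOfKey_lt_iff {f : Fin n → ℕ} {tie : Pref n} {x y : Fin n} :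
    prefOfKey f tie x < prefOfKey f tie y ↔ f x < f y ∨ f x = f y ∧ tie x < tie y :=
  (exists_pref_of_key f tie).choose_spec x y

theorem prefOfKey_lt {f : Fin n → ℕ} {tie : Pref n} {x y : Fin n} (h : f x < f y) :
    prefOfKey f tie x < prefOfKey f tie y :=
  prefOfKey_lt_iff.mpr (Or.inl h)

theorem key_le_of_prefOfKey_le {f : Fin n → ℕ} {tie : Pref n} {x y : Fin n}
    (h : prefOfKey f tie x ≤ prefOfKey f tie y) : f x ≤ f y :=
  not_lt.mp fun h' => absurd h (not_le.mpr (prefOfKey_lt h'))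

/-! ### A linear lower bound on the optimum -/

theorem exists_swap_of_untouched {PA PB : Profile n} {qs : List (Fin n × Fin n)} {M : Matching n}
    {b₁ b₂ : Fin n} (hne : b₁ ≠ b₂)
    (hb : ∀ q ∈ qs, q.1 ≠ b₁ ∧ q.1 ≠ b₂ ∧ M q.2 ≠ b₁ ∧ M q.2 ≠ b₂) :
    ∃ PB', Agree PB' PB qs.toFinset ∧ ¬ IsBOptimal PA PB' M := by
  classical
  set a₁ := M.symm b₁ with ha₁
  set a₂ := M.symm b₂ with ha₂
  have hM₁ : M a₁ = b₁ := M.apply_symm_apply b₁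
  have hM₂ : M a₂ = b₂ := M.apply_symm_apply b₂
  have hane : a₁ ≠ a₂ := fun h => hne (M.symm.injective h)
  -- `b₁` and `b₂` put each other's partner first; all others put `a₁` and `a₂` last, so neither can
  -- block. Breaking ties by `PB b` preserves every comparison that was revealed.
  let PB' : Profile n := fun b =>
    if b = b₁ then prefOfKey (fun x => if x = a₂ then 0 else 1) (PB b)
    else if b = b₂ then prefOfKey (fun x => if x = a₁ then 0 else 1) (PB b)
    else prefOfKey (fun x => if x = a₁ ∨ x = a₂ then 1 else 0) (PB b)
  have h₁ : ∀ x, x ≠ a₂ → PB' b₁ a₂ < PB' b₁ x := by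
    intro x hx
    simp only [PB', if_true]
    exact prefOfKey_lt (by simp [hx])
  have h₂ : ∀ x, x ≠ a₁ → PB' b₂ a₁ < PB' b₂ x := by
    intro x hx
    simp only [PB', if_true, if_neg hne.symm]
    exact prefOfKey_lt (by simp [hx])
  have h₃ : ∀ b, b ≠ b₁ → b ≠ b₂ → ∀ x, PB' b x < PB' b (M.symm b) → x ≠ a₁ ∧ x ≠ a₂ := by
    intro b hb₁ hb₂ x hx
    simp only [PB', if_neg hb₁, if_neg hb₂] at hx
    have := key_le_of_prefOfKey_le hx.le
    have e₁ : M.symm b ≠ a₁ := fun h => hb₁ (M.symm.injective h)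
    have e₂ : M.symm b ≠ a₂ := fun h => hb₂ (M.symm.injective h)
    by_contra hcon
    have hx' : x = a₁ ∨ x = a₂ := by tauto
    simp [hx', e₁, e₂] at this
  refine ⟨PB', ?_, ?_⟩
  · intro b x y hx hy
    rw [List.mem_toFinset] at hx hy
    obtain ⟨hb₁, hb₂, hx₁, hx₂⟩ := hb _ hx
    obtain ⟨-, -, hy₁, hy₂⟩ := hb _ hy
    have hx₁ : x ≠ a₁ := by rintro rfl; exact hx₁ hM₁
    have hx₂ : x ≠ a₂ := by rintro rfl; exact hx₂ hM₂
    have hy₁ : y ≠ a₁ := by rintro rfl; exact hy₁ hM₁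
    have hy₂ : y ≠ a₂ := by rintro rfl; exact hy₂ hM₂
    simp only [Prefers, PB']
    rw [if_neg hb₁, if_neg hb₂, prefOfKey_lt_iff]
    simp [hx₁, hx₂, hy₁, hy₂]
  · rintro ⟨hst, hopt⟩
    have e₁ : ((Equiv.swap a₁ a₂).trans M).symm b₁ = a₂ := by
      simp [← ha₁]
    have e₂ : ((Equiv.swap a₁ a₂).trans M).symm b₂ = a₁ := by
      simp [← ha₂]
    refine hopt ((Equiv.swap a₁ a₂).trans M) ?_ b₁ ?_
    · rintro a b ⟨hab, hA, hB⟩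
      by_cases hb₁ : b = b₁
      · subst hb₁
        rw [e₁] at hB
        by_cases h : a = a₂
        · subst h; exact lt_irrefl _ hB
        · exact lt_asymm hB (h₁ a h)
      by_cases hb₂ : b = b₂
      · subst hb₂
        rw [e₂] at hB
        by_cases h : a = a₁
        · subst h; exact lt_irrefl _ hB
        · exact lt_asymm hB (h₂ a h)
      have e : ((Equiv.swap a₁ a₂).trans M).symm b = M.symm b := by
        simp only [Equiv.symm_trans_apply, Equiv.symm_swap]
        exact Equiv.swap_apply_of_ne_of_ne (fun h => hb₁ (M.symm.injective h))
          (fun h => hb₂ (M.symm.injective h))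
      rw [e] at hB
      obtain ⟨hx₁, hx₂⟩ := h₃ b hb₁ hb₂ a hB
      have e' : ((Equiv.swap a₁ a₂).trans M) a = M a := by
        simp [Equiv.swap_apply_of_ne_of_ne hx₁ hx₂]
      rw [e'] at hab hA
      -- Neither `a` nor `b` is affected by the exchange, so the pair would already block `M`.
      exact hst a b ⟨hab, hA, hB⟩
    · rw [e₁]
      exact h₁ _ hane

/-- Each interview touches at most two pairs of `M`, and at most one pair may remain untouched. -/
theorem Proves.le_length {PA PB : Profile n} {qs : List (Fin n × Fin n)} (h : Proves PA PB qs) :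
    n ≤ 2 * qs.length + 1 := by
  classical
  obtain ⟨M, hM⟩ := h
  by_contra! hlt
  let T : Finset (Fin n) := (qs.map Prod.fst).toFinset ∪ (qs.map fun q => M q.2).toFinset
  have hT : T.card ≤ 2 * qs.length := by
    refine (Finset.card_union_le _ _).trans ?_
    have := List.toFinset_card_le (qs.map Prod.fst)
    have := List.toFinset_card_le (qs.map fun q => M q.2)
    simp only [List.length_map] at *
    omega
  have hc : 1 < Tᶜ.card := by
    rw [Finset.card_compl, Fintype.card_fin]
    omega
  obtain ⟨b₁, hb₁, b₂, hb₂, hne⟩ := Finset.one_lt_card.mp hc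
  have hmem : ∀ b ∈ Tᶜ, ∀ q ∈ qs, q.1 ≠ b ∧ M q.2 ≠ b := by
    intro b hb q hq
    rw [Finset.mem_compl] at hb
    constructor <;> rintro rfl <;> apply hb <;>
      simp only [T, Finset.mem_union, List.mem_toFinset, List.mem_map]
    · exact Or.inl ⟨q, hq, rfl⟩
    · exact Or.inr ⟨q, hq, rfl⟩
  obtain ⟨PB', hag, hno⟩ := exists_swap_of_untouched (PA := PA) (PB := PB) (M := M) hne
    fun q hq => ⟨(hmem b₁ hb₁ q hq).1, (hmem b₂ hb₂ q hq).1, (hmem b₁ hb₁ q hq).2,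
      (hmem b₂ hb₂ q hq).2⟩
  exact hno (hM PB' ((transcript_eq_iff qs).mpr hag))

theorem le_two_mul_opt_add_one (PA PB : Profile n) : n ≤ 2 * opt PA PB + 1 := by
  obtain ⟨qs, hqs, hp⟩ := exists_proves_length_eq_opt PA PB
  exact hqs ▸ hp.le_length

theorem exists_detAlg_isCompetitive (n : ℕ) :
    ∃ D : DetAlg n, D.IsCompetitive (4 * n : ℝ≥0) := by
  rcases Nat.lt_or_ge n 2 with hn | hn
  · have : Subsingleton (Fin n) := Fin.subsingleton_iff_le_one.mpr (by omega)
    refine ⟨fun _ => .output 1, fun PA PB => ⟨?_, ?_⟩, fun PA PB => by simp [Strategy.cost]⟩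
    · rintro a b ⟨h, -⟩
      exact h (Subsingleton.elim _ _)
    · intro M _ b h
      exact absurd h (by rw [Subsingleton.elim (M.symm b)]; exact lt_irrefl _)
  · choose D hD hcost using exists_findsBOptimal (n := n)
    refine ⟨D, hD, fun PA PB => ?_⟩
    rw [hcost]
    have h := le_two_mul_opt_add_one PA PB
    have : n * n ≤ 4 * n * opt PA PB := by nlinarith
    exact_mod_cast this

/-! ### The interviews executed by a strategy -/

/-- The set of all executed interviews at the moment when the strategy stops. -/
def Strategy.executed (PB : Profile n) :
    Strategy n → Finset (Fin n × Fin n) → Finset (Fin n × Fin n)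
  | .output _, asked => asked
  | .query b a next, asked => (next (intq PB asked b a)).executed PB (insert (b, a) asked)

theorem Strategy.subset_executed (PB : Profile n) (S : Strategy n)
    (asked : Finset (Fin n × Fin n)) : asked ⊆ S.executed PB asked := by
  induction S generalizing asked with
  | output M => exact Finset.Subset.refl _
  | query b a next ih => exact (Finset.subset_insert _ _).trans (ih _ _)

theorem Strategy.card_executed_le (PB : Profile n) (S : Strategy n)
    (asked : Finset (Fin n × Fin n)) :
    (S.executed PB asked).card ≤ asked.card + S.cost PB asked := by
  induction S generalizing asked with
  | output M => exact le_rfl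
  | query b a next ih =>
    have h₁ := ih (intq PB asked b a) (insert (b, a) asked)
    have h₂ := Finset.card_insert_le (b, a) asked
    simp only [Strategy.executed, Strategy.cost]
    omega

theorem Strategy.result_congr {PB PB' : Profile n} (S : Strategy n)
    (asked : Finset (Fin n × Fin n)) (h : Agree PB PB' (S.executed PB asked)) :
    S.result PB asked = S.result PB' asked := by
  induction S generalizing asked with
  | output M => rfl
  | query b a next ih =>
    have h' := h.mono (Strategy.subset_executed PB (next (intq PB asked b a)) (insert (b, a) asked))
    have hq : intq PB asked b a = intq PB' asked b a := intq_congr fun x y => h' b x y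
    simp only [Strategy.result]
    rw [← hq]
    exact ih _ _ h

/-- If the profiles `PB j` can only be told apart by means of the interviews `q j`, and the strategy
executes `q j` on `PB j`, then it finds `q j` by searching through the interviews `q j'`. -/
theorem Strategy.card_mul_succ_le_of_finds {J : Type*} [DecidableEq J] {PB : J → Profile n}
    {q : J → Fin n × Fin n} (hq : Function.Injective q)
    (hag : ∀ s : Finset (Fin n × Fin n), ∀ j j', q j ∉ s → q j' ∉ s → Agree (PB j) (PB j') s)
    (S : Strategy n) (asked : Finset (Fin n × Fin n)) (U : Finset J)
    (hU : ∀ j ∈ U, q j ∉ asked) (hS : ∀ j ∈ U, q j ∈ S.executed (PB j) asked) :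
    U.card * (U.card + 1) ≤
      2 * ∑ j ∈ U, (U.filter fun j' => q j' ∈ S.executed (PB j) asked).card := by
  induction S generalizing asked U with
  | output M =>
    have : U = ∅ := Finset.eq_empty_of_forall_notMem fun j hj => hU j hj (hS j hj)
    simp [this]
  | query b a next ih =>
    set V := U.filter fun j => q j ≠ (b, a) with hV
    have hVU : V ⊆ U := Finset.filter_subset _ _
    have hVn : ∀ j ∈ V, q j ∉ insert (b, a) asked := by
      intro j hj
      rw [hV, Finset.mem_filter] at hj
      simp [hj.2, hU j hj.1]
    obtain ⟨ans, hans⟩ : ∃ ans, ∀ j ∈ V, intq (PB j) asked b a = ans := by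
      rcases V.eq_empty_or_nonempty with h | ⟨j₀, hj₀⟩
      · exact ⟨∅, by simp [h]⟩
      -- As long as their own interviews are not executed, the profiles give the same answer, so the
      -- strategy continues along one common branch.
      · exact ⟨intq (PB j₀) asked b a, fun j hj => intq_congr fun x y =>
          hag _ j j₀ (hVn j hj) (hVn j₀ hj₀) b x y⟩
    have hex : ∀ j ∈ V, (Strategy.query b a next).executed (PB j) asked =
        (next ans).executed (PB j) (insert (b, a) asked) := by
      intro j hj
      rw [Strategy.executed, hans j hj]
    have hIH := ih ans (insert (b, a) asked) V hVn fun j hj => by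
      rw [← hex j hj]; exact hS j (hVU hj)
    have hIH' : V.card * (V.card + 1) ≤ 2 * ∑ j ∈ V, (V.filter fun j' =>
        q j' ∈ (Strategy.query b a next).executed (PB j) asked).card := by
      refine hIH.trans_eq ?_
      congr 1
      exact Finset.sum_congr rfl fun j hj => by rw [hex j hj]
    by_cases hj₀ : ∃ j₀ ∈ U, q j₀ = (b, a)
    · obtain ⟨j₀, hj₀U, hj₀⟩ := hj₀
      have hj₀V : j₀ ∉ V := by simp [hV, hj₀]
      have hUV : U = insert j₀ V := by
        ext j
        simp only [hV, Finset.mem_insert, Finset.mem_filter]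
        constructor
        · intro hj
          by_cases h : q j = (b, a)
          · exact Or.inl (hq (h.trans hj₀.symm))
          · exact Or.inr ⟨hj, h⟩
        · rintro (rfl | h)
          · exact hj₀U
          · exact h.1
      -- Finding `j₀` adds one to the count of every `j ∈ U`, as this interview is executed on all
      -- of these profiles: the sum grows by at least `V.card + 1`.
      have hmem : ∀ j, q j₀ ∈ (Strategy.query b a next).executed (PB j) asked := fun j =>
        hj₀ ▸ Strategy.subset_executed (PB j) (next _) _ (Finset.mem_insert_self (b, a) asked)
      have hcard : ∀ j, (V.filter fun j' =>
            q j' ∈ (Strategy.query b a next).executed (PB j) asked).card + 1 =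
          (U.filter fun j' => q j' ∈ (Strategy.query b a next).executed (PB j) asked).card := by
        intro j
        rw [hUV, Finset.filter_insert, if_pos (hmem j), Finset.card_insert_of_notMem]
        exact fun h => hj₀V (Finset.mem_filter.mp h).1
      simp only [← hcard]
      rw [hUV, Finset.sum_insert hj₀V, Finset.card_insert_of_notMem hj₀V, Finset.sum_add_distrib]
      simp only [Finset.sum_const, smul_eq_mul, mul_one]
      nlinarith
    · push Not at hj₀
      have hUV : V = U := Finset.filter_true_of_mem hj₀
      rwa [hUV] at hIH'

/-! ### A certificate for the identity matching -/

/-- Induction on `h`. If `d` were not matched to its counterpart, its partner would block with its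
own counterpart. For `x ≠ d`, all agents of `B` that `x` ranks up to `g x`, except its counterpart,
are already taken. If `x` does not get its counterpart, it gets someone worse than `g x` and blocks
with `g x`. -/
theorem eq_one_of_isStable {PA PB : Profile n} {d : Fin n} {g : Fin n → Fin n} {h : Fin n → ℕ}
    (htop : ∀ x y, y ≠ x → Prefers (PA x) x y) (hd : ∀ b, b ≠ d → Prefers (PB b) b d)
    (hg : ∀ x, x ≠ d → Prefers (PB (g x)) x (g x))
    (hh : ∀ x, x ≠ d → ∀ y, y ≠ x → PA x y ≤ PA x (g x) → h y < h x)
    {M : Matching n} (hM : IsStable PA PB M) : M = 1 := by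
  have hfix : ∀ N, ∀ x, h x = N → M x = x := by
    intro N
    induction N using Nat.strong_induction_on with
    | _ N ih =>
      intro x hx
      by_contra hne
      by_cases hxd : x = d
      · subst hxd
        have hlt := hd (M x) hne
        refine hM (M x) (M x) ⟨fun h' => hne (M.injective h'), ?_, by simpa using hlt⟩
        exact htop _ _ fun h' => hne (M.injective h')
      · have hgx : g x ≠ x := by
          intro h'
          have := hg x hxd
          rw [h'] at this
          exact lt_irrefl _ this
        have hlt : PA x (g x) < PA x (M x) := by
          by_contra hle
          have h' := hh x hxd _ hne (not_lt.mp hle)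
          exact hne (M.injective (ih _ (hx ▸ h') _ rfl))
        have hfix := ih _ (hx ▸ hh x hxd _ hgx le_rfl) _ rfl
        refine hM x (g x) ⟨hlt.ne' ∘ congrArg _, hlt, ?_⟩
        rw [show M.symm (g x) = g x from M.symm_apply_eq.mpr hfix.symm]
        exact hg x hxd
  exact Equiv.ext fun x => hfix _ x rfl

theorem isBOptimal_one {PA PB : Profile n} {d : Fin n} {g : Fin n → Fin n} {h : Fin n → ℕ}
    (htop : ∀ x y, y ≠ x → Prefers (PA x) x y) (hd : ∀ b, b ≠ d → Prefers (PB b) b d)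
    (hg : ∀ x, x ≠ d → Prefers (PB (g x)) x (g x))
    (hh : ∀ x, x ≠ d → ∀ y, y ≠ x → PA x y ≤ PA x (g x) → h y < h x) :
    IsBOptimal PA PB 1 := by
  refine ⟨fun a b hab => lt_asymm hab.2.1 (htop a b hab.1.symm), fun M hM b => ?_⟩
  rw [eq_one_of_isStable htop hd hg hh hM]
  exact lt_irrefl _

/-- Only `hd` and `hg` concern the unknown side, and each of their comparisons involves two agents
interviewed in `qs`. -/
theorem opt_le_of_certificate {PA PB : Profile n} {d : Fin n} {g : Fin n → Fin n}
    {h : Fin n → ℕ}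
    (htop : ∀ x y, y ≠ x → Prefers (PA x) x y) (hd : ∀ b, b ≠ d → Prefers (PB b) b d)
    (hg : ∀ x, x ≠ d → Prefers (PB (g x)) x (g x))
    (hh : ∀ x, x ≠ d → ∀ y, y ≠ x → PA x y ≤ PA x (g x) → h y < h x) :
    opt PA PB ≤ 3 * n := by
  let qs : List (Fin n × Fin n) := (List.finRange n).map (fun x => (x, x)) ++
    ((List.finRange n).map (fun x => (x, d)) ++ (List.finRange n).map (fun x => (g x, x)))
  have hlen : qs.length = 3 * n := by simp [qs]; ring
  rw [← hlen]
  refine opt_le_length ⟨1, fun PB' ht => ?_⟩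
  rw [transcript_eq_iff] at ht
  have m₁ : ∀ x, (x, x) ∈ qs.toFinset := fun x => by simp [qs]
  have m₂ : ∀ x, (x, d) ∈ qs.toFinset := fun x => by simp [qs]
  have m₃ : ∀ x, (g x, x) ∈ qs.toFinset := fun x => by simp [qs]
  exact isBOptimal_one htop (fun b hb => (ht b b d (m₁ b) (m₂ b)).mpr (hd b hb))
    (fun x hx => (ht _ _ _ (m₃ x) (m₁ _)).mpr (hg x hx)) hh

/-! ### The hard instances -/

/-- The labels of the agents of either side in the hard instances. The agents of `A` are the
searchers, their companions, and the hubs; each is the first choice of its counterpart. -/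
abbrev Label (m k : ℕ) := Fin m ⊕ Fin m ⊕ Fin (k + 1)

variable {m k : ℕ}

/-- A searcher likes its counterpart, then all hubs, then the counterpart of its companion. A
companion likes its counterpart, then that of its searcher. A hub likes its counterpart, then
hub `0`. -/
def keyA : Label m k → Label m k → ℕ
  | .inl i, .inl i' => if i' = i then 0 else 3
  | .inl _, .inr (.inr _) => 1
  | .inl i, .inr (.inl i') => if i' = i then 2 else 3
  | .inr (.inl i), .inr (.inl i') => if i' = i then 0 else 2
  | .inr (.inl i), .inl i' => if i' = i then 1 else 2
  | .inr (.inl _), .inr (.inr _) => 2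
  | .inr (.inr j), .inr (.inr j') => if j' = j then 0 else if j' = 0 then 1 else 2
  | .inr (.inr _), _ => 2

/-- The searcher `i` is liked by the hub `r i` only. -/
def keyB (r : Fin m → Option (Fin (k + 1))) : Label m k → Label m k → ℕ
  | .inl i, .inr (.inl i') => if i' = i then 0 else 2
  | .inl i, .inl i' => if i' = i then 1 else 2
  | .inl _, .inr (.inr _) => 2
  | .inr (.inl i), .inl i' => if i' = i then 0 else 2
  | .inr (.inl i), .inr (.inl i') => if i' = i then 1 else 2
  | .inr (.inl _), .inr (.inr _) => 2
  | .inr (.inr j), .inl i => if r i = some j then 0 else 4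
  | .inr (.inr j), .inr (.inr j') => if j' = j then 2 else if j = 0 then 1 else 3
  | .inr (.inr _), .inr (.inl _) => 4

/-- The `A`-side profile of the hard instances. -/
noncomputable def hardA (e : Label m k ≃ Fin n) : Profile n :=
  fun x => prefOfKey (fun y => keyA (e.symm x) (e.symm y)) 1

/-- The `B`-side profile of a hard instance. -/
noncomputable def hardB (e : Label m k ≃ Fin n) (r : Fin m → Option (Fin (k + 1))) : Profile n :=
  fun x => prefOfKey (fun y => keyB r (e.symm x) (e.symm y)) 1

section
variable (e : Label m k ≃ Fin n) {r r' : Fin m → Option (Fin (k + 1))} {s t u : Label m k}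

theorem hardA_lt (h : keyA s t < keyA s u) : hardA e (e s) (e t) < hardA e (e s) (e u) :=
  prefOfKey_lt (by simpa using h)

theorem hardA_le (h : hardA e (e s) (e t) ≤ hardA e (e s) (e u)) : keyA s t ≤ keyA s u := by
  simpa using key_le_of_prefOfKey_le h

theorem hardB_lt (h : keyB r s t < keyB r s u) : hardB e r (e s) (e t) < hardB e r (e s) (e u) :=
  prefOfKey_lt (by simpa using h)

theorem hardB_le (h : hardB e r (e s) (e t) ≤ hardB e r (e s) (e u)) :
    keyB r s t ≤ keyB r s u := by
  simpa using key_le_of_prefOfKey_le h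

/-- The interview of hub `j` with searcher `i`. -/
def hubQuery (i : Fin m) (j : Fin (k + 1)) : Fin n × Fin n := (e (.inr (.inr j)), e (.inl i))

theorem agree_hardB {i : Fin m} (hr : ∀ i', i' ≠ i → r i' = r' i')
    {asked : Finset (Fin n × Fin n)}
    (h : ∀ j, r i = some j ∨ r' i = some j → hubQuery e i j ∉ asked) :
    Agree (hardB e r) (hardB e r') asked := by
  have key : ∀ s t, (e s, e t) ∈ asked → keyB r s t = keyB r' s t := by
    intro s t hst
    rcases s with i₁ | i₁ | j <;> rcases t with i₂ | i₂ | j₂ <;> try rfl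
    simp only [keyB]
    by_cases hi : i₂ = i
    · subst hi
      have hj : ¬ (r i₂ = some j ∨ r' i₂ = some j) := fun hj => h j hj hst
      rw [not_or] at hj
      rw [if_neg hj.1, if_neg hj.2]
    · rw [hr i₂ hi]
  intro b x y hx hy
  obtain ⟨s, rfl⟩ := e.surjective b
  obtain ⟨t, rfl⟩ := e.surjective x
  obtain ⟨u, rfl⟩ := e.surjective y
  simp only [Prefers, hardB, prefOfKey_lt_iff, Equiv.symm_apply_apply, key s t hx, key s u hy]

theorem hardA_top (x y : Fin n) (hxy : y ≠ x) : Prefers (hardA e x) x y := by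
  obtain ⟨s, rfl⟩ := e.surjective x
  obtain ⟨t, rfl⟩ := e.surjective y
  have hst : t ≠ s := fun h => hxy (congrArg e h)
  apply hardA_lt
  rcases s with i | i | j <;> rcases t with i' | i' | j' <;>
    simp_all [keyA] <;> split_ifs <;> simp

theorem hardB_hub (b : Fin n) (hb : b ≠ e (.inr (.inr 0))) :
    Prefers (hardB e r b) b (e (.inr (.inr 0))) := by
  obtain ⟨s, rfl⟩ := e.surjective b
  have hs : s ≠ .inr (.inr 0) := fun h => hb (congrArg e h)
  apply hardB_lt
  rcases s with i | i | j
  · simp [keyB]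
  · simp [keyB]
  · have hj : j ≠ 0 := fun h => hs (by rw [h])
    simp [keyB, hj, hj.symm]

/-- The agents of `B` that keep the counterparts of other agents in place. -/
def guard (f : Fin m → Fin (k + 1)) : Label m k → Label m k
  | .inl i => .inr (.inr (f i))
  | .inr (.inl i) => .inl i
  | .inr (.inr _) => .inr (.inr 0)

/-- The order in which the agents of `A` are seen to be matched to their counterparts. -/
def level : Label m k → ℕ
  | .inl _ => 2
  | .inr (.inl _) => 3
  | .inr (.inr j) => if j = 0 then 0 else 1

theorem hardB_guard (f : Fin m → Fin (k + 1)) (x : Fin n) (hx : x ≠ e (.inr (.inr 0))) :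
    Prefers (hardB e (fun i => some (f i)) (e (guard f (e.symm x)))) x
      (e (guard f (e.symm x))) := by
  obtain ⟨s, rfl⟩ := e.surjective x
  have hs : s ≠ .inr (.inr 0) := fun h => hx (congrArg e h)
  rw [Equiv.symm_apply_apply]
  apply hardB_lt
  rcases s with i | i | j
  · simp [keyB, guard]
  · simp [keyB, guard]
  · have hj : j ≠ 0 := fun h => hs (by rw [h])
    simp [keyB, guard, hj]

theorem level_lt (f : Fin m → Fin (k + 1)) (x : Fin n) (hx : x ≠ e (.inr (.inr 0))) (y : Fin n)
    (hyx : y ≠ x) (h : hardA e x y ≤ hardA e x (e (guard f (e.symm x)))) :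
    level (e.symm y) < level (e.symm x) := by
  obtain ⟨s, rfl⟩ := e.surjective x
  obtain ⟨t, rfl⟩ := e.surjective y
  have hs : s ≠ .inr (.inr 0) := fun h => hx (congrArg e h)
  have hst : t ≠ s := fun h => hyx (congrArg e h)
  rw [Equiv.symm_apply_apply] at h
  rw [Equiv.symm_apply_apply, Equiv.symm_apply_apply]
  have h := hardA_le e h
  rcases s with i | i | j <;> rcases t with i' | i' | j' <;>
    simp_all [keyA, guard, level] <;> grind

theorem opt_hard_le (f : Fin m → Fin (k + 1)) :
    opt (hardA e) (hardB e fun i => some (f i)) ≤ 3 * n :=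
  opt_le_of_certificate (hardA_top e) (hardB_hub e) (hardB_guard e f) (level_lt e f)

theorem isBOptimal_hard_eq_one (f : Fin m → Fin (k + 1)) {M : Matching n}
    (hM : IsBOptimal (hardA e) (hardB e fun i => some (f i)) M) : M = 1 :=
  eq_one_of_isStable (hardA_top e) (hardB_hub e) (hardB_guard e f) (level_lt e f) hM.1

/-- Without a hub that likes searcher `i`, it can exchange partners with its companion. The two
counterparts then have their first choices, and every hub prefers its own counterpart to the
searcher, so nothing blocks. -/
theorem not_isBOptimal_one_hard {i : Fin m} (hi : r i = none) :
    ¬ IsBOptimal (hardA e) (hardB e r) 1 := by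
  intro hopt
  set a := e (.inl i) with ha
  set c := e (.inr (.inl i)) with hc
  have hac : a ≠ c := fun h => by simpa using e.injective h
  refine hopt.2 (Equiv.swap a c) ?_ a ?_
  · rintro x y ⟨hxy, hA, hB⟩
    rw [Equiv.symm_swap] at hB
    by_cases hxa : x = a
    · subst hxa
      rw [Equiv.swap_apply_left] at hxy hA
      obtain ⟨t, rfl⟩ := e.surjective y
      have hk := hardA_le e hA.le
      rcases t with i' | i' | j
      · by_cases h : i' = i
        · subst h
          rw [← ha, Equiv.swap_apply_left] at hB
          have := hardB_le e hB.le
          simp [keyB] at this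
        · simp [keyA, h] at hk
      · by_cases h : i' = i
        · subst h; exact hxy rfl
        · simp [keyA, h] at hk
      · rw [Equiv.swap_apply_of_ne_of_ne (by simp [ha]) (by simp [hc])] at hB
        have := hardB_le e hB.le
        simp [keyB, hi] at this
    by_cases hxc : x = c
    · subst hxc
      rw [Equiv.swap_apply_right] at hxy hA
      obtain ⟨t, rfl⟩ := e.surjective y
      have hk := hardA_le e hA.le
      rcases t with i' | i' | j
      · by_cases h : i' = i
        · subst h; exact hxy rfl
        · simp [keyA, h] at hk
      · by_cases h : i' = i
        · subst h
          rw [← hc, Equiv.swap_apply_right] at hB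
          have := hardB_le e hB.le
          simp [keyB] at this
        · simp [keyA, h] at hk
      · simp [keyA] at hk
    · rw [Equiv.swap_apply_of_ne_of_ne hxa hxc] at hxy hA
      exact lt_asymm hA (hardA_top e x y hxy.symm)
  · rw [Equiv.symm_swap, Equiv.swap_apply_left]
    exact hardB_lt e (by simp [keyB])

theorem hubQuery_mem_executed {S : Strategy n} (hS : S.FindsBOptimal (hardA e))
    (f : Fin m → Fin (k + 1)) (i : Fin m) :
    hubQuery e i (f i) ∈ S.executed (hardB e fun i => some (f i)) ∅ := by
  by_contra hmem
  -- Deleting `f i` would go unnoticed, and the output would still be the identity.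
  have hag : Agree (hardB e fun i => some (f i))
      (hardB e (Function.update (fun i => some (f i)) i none))
      (S.executed (hardB e fun i => some (f i)) ∅) := by
    refine agree_hardB e (i := i) (fun i' hi' => by simp [hi']) ?_
    rintro j (h | h)
    · rwa [← Option.some.inj h]
    · simp at h
  have hres := S.result_congr ∅ hag
  rw [isBOptimal_hard_eq_one e f (hS _)] at hres
  have := hS (hardB e (Function.update (fun i => some (f i)) i none))
  rw [← hres] at this
  exact not_isBOptimal_one_hard e (i := i) (by simp) this

/-! ### The lower bound -/

/-- Resampling one coordinate preserves the uniform distribution: exchanging `f i` with `j` is an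
involution. -/
theorem sum_sum_update {J : Type*} [Fintype J] (i : Fin m) (F : (Fin m → J) → ℕ) :
    ∑ f : Fin m → J, ∑ j, F (Function.update f i j) = Fintype.card J * ∑ f, F f := by
  let φ : (Fin m → J) × J → (Fin m → J) × J := fun p => (Function.update p.1 i p.2, p.1 i)
  have hφ : Function.Involutive φ := fun p => by simp [φ]
  calc ∑ f : Fin m → J, ∑ j, F (Function.update f i j)
      = ∑ p : (Fin m → J) × J, F (φ p).1 := by rw [Fintype.sum_prod_type]
    _ = ∑ p : (Fin m → J) × J, F p.1 := Equiv.sum_comp (hφ.toPerm φ) fun p => F p.1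
    _ = Fintype.card J * ∑ f, F f := by
      rw [Fintype.sum_prod_type]
      simp [Finset.mul_sum]

/-- With the other coordinates fixed, `S` searches for `f i` among `k + 1` hubs; then the average
over these coordinates is taken. -/
theorem sum_card_hubQuery {S : Strategy n} (hS : S.FindsBOptimal (hardA e)) (i : Fin m) :
    (k + 1) ^ m * (k + 2) ≤ 2 * ∑ f : Fin m → Fin (k + 1), (Finset.univ.filter fun j =>
      hubQuery e i j ∈ S.executed (hardB e fun i => some (f i)) ∅).card := by
  have hinj : Function.Injective (hubQuery e i (k := k)) := by
    intro j j' h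
    simpa [hubQuery] using h
  have h : ∀ f : Fin m → Fin (k + 1), (k + 1) * (k + 2) ≤ 2 * ∑ j, (Finset.univ.filter fun j' =>
      hubQuery e i j' ∈
        S.executed (hardB e fun i' => some (Function.update f i j i')) ∅).card := by
    intro f
    have := S.card_mul_succ_le_of_finds
      (PB := fun j => hardB e fun i' => some (Function.update f i j i')) hinj
      (fun s j j' hj hj' => agree_hardB e (i := i) (fun i' hi' => by simp [hi']) ?_) ∅
      Finset.univ (by simp) fun j _ => ?_
    · simpa using this
    · rintro j'' (h | h)
      · simp only [Function.update_self, Option.some.injEq] at h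
        rwa [← h]
      · simp only [Function.update_self, Option.some.injEq] at h
        rwa [← h]
    · simpa using hubQuery_mem_executed e hS (Function.update f i j) i
  have hsum := Finset.sum_le_sum fun f (_ : f ∈ Finset.univ) => h f
  rw [← Finset.mul_sum Finset.univ _ 2, sum_sum_update i fun f => (Finset.univ.filter fun j' =>
      hubQuery e i j' ∈ S.executed (hardB e fun i' => some (f i')) ∅).card] at hsum
  simp only [Finset.sum_const, Finset.card_univ, Fintype.card_fun, Fintype.card_fin,
    smul_eq_mul] at hsum
  refine Nat.le_of_mul_le_mul_left (c := k + 1) ?_ k.succ_pos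
  calc _ = (k + 1) ^ m * ((k + 1) * (k + 2)) := by ring
    _ ≤ _ := hsum
    _ = _ := by ring

theorem sum_card_le_cost (S : Strategy n) (PB : Profile n) :
    ∑ i : Fin m, (Finset.univ.filter fun j : Fin (k + 1) =>
      hubQuery e i j ∈ S.executed PB ∅).card ≤ S.cost PB ∅ := by
  rw [← Finset.card_sigma]
  refine le_trans (Finset.card_le_card_of_injOn (t := S.executed PB ∅)
    (fun p => hubQuery e p.1 p.2) ?_ ?_) (by simpa using S.card_executed_le PB ∅)
  · rintro ⟨i, j⟩ h
    simpa using h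
  · rintro ⟨i, j⟩ - ⟨i', j'⟩ - h
    simp only [hubQuery, Prod.mk.injEq, EmbeddingLike.apply_eq_iff_eq, Sum.inr.injEq,
      Sum.inl.injEq] at h
    rw [h.1, h.2]

theorem sum_cost_ge {S : Strategy n} (hS : S.FindsBOptimal (hardA e)) :
    m * ((k + 1) ^ m * (k + 2)) ≤
      2 * ∑ f : Fin m → Fin (k + 1), S.cost (hardB e fun i => some (f i)) ∅ := by
  calc m * ((k + 1) ^ m * (k + 2)) = ∑ i : Fin m, (k + 1) ^ m * (k + 2) := by simp
    _ ≤ ∑ i : Fin m, 2 * ∑ f : Fin m → Fin (k + 1), (Finset.univ.filter fun j =>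
          hubQuery e i j ∈ S.executed (hardB e fun i => some (f i)) ∅).card :=
        Finset.sum_le_sum fun i _ => sum_card_hubQuery e hS i
    _ = 2 * ∑ f : Fin m → Fin (k + 1), ∑ i, (Finset.univ.filter fun j =>
          hubQuery e i j ∈ S.executed (hardB e fun i => some (f i)) ∅).card := by
        rw [← Finset.mul_sum, Finset.sum_comm]
    _ ≤ _ := Nat.mul_le_mul_left _ (Finset.sum_le_sum fun f _ => sum_card_le_cost e S _)

end

theorem mul_le_of_isCompetitive (e : Label m k ≃ Fin n) {R : RandAlg n} {ρ : ℝ≥0} (hR : R.IsCompetitive ρ) :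
    (m * (k + 2) : ℝ≥0) ≤ 6 * n * ρ := by
  let C : (Fin m → Fin (k + 1)) → Strategy n → ℕ :=
    fun f S => S.cost (hardB e fun i => some (f i)) ∅
  have hlow : ((m * ((k + 1) ^ m * (k + 2)) : ℕ) : ℝ≥0∞) ≤
      2 * ∑ f : Fin m → Fin (k + 1), R.expectedCost (hardA e) (hardB e fun i => some (f i)) := by
    calc ((m * ((k + 1) ^ m * (k + 2)) : ℕ) : ℝ≥0∞)
        = ∑' S, R (hardA e) S * ((m * ((k + 1) ^ m * (k + 2)) : ℕ) : ℝ≥0∞) := by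
          rw [ENNReal.tsum_mul_right, PMF.tsum_coe, one_mul]
      _ ≤ ∑' S, R (hardA e) S * ((2 * ∑ f : Fin m → Fin (k + 1), C f S : ℕ) : ℝ≥0∞) := by
          refine ENNReal.tsum_le_tsum fun S => ?_
          -- Correctness is guaranteed only on the support; elsewhere the weight vanishes.
          by_cases hS : S ∈ (R (hardA e)).support
          · exact mul_le_mul' le_rfl (Nat.cast_le.mpr (sum_cost_ge e (hR.1 _ S hS)))
          · simp [(PMF.apply_eq_zero_iff _ _).mpr hS]
      _ = ∑' S, 2 * ∑ f : Fin m → Fin (k + 1), R (hardA e) S * (C f S : ℝ≥0∞) := by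
          refine tsum_congr fun S => ?_
          push_cast
          rw [← Finset.mul_sum]
          ring
      _ = _ := by
          rw [ENNReal.tsum_mul_left, Summable.tsum_finsetSum fun _ _ => ENNReal.summable]
          rfl
  have hup : ∑ f : Fin m → Fin (k + 1), R.expectedCost (hardA e) (hardB e fun i => some (f i)) ≤
      ((k + 1 : ℝ≥0∞) ^ m) * (ρ * (3 * n : ℕ)) := by
    calc _ ≤ ∑ _f : Fin m → Fin (k + 1), (ρ : ℝ≥0∞) * (3 * n : ℕ) := by
          refine Finset.sum_le_sum fun f _ => (hR.2 _ _).trans ?_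
          gcongr
          exact opt_hard_le e f
      _ = _ := by simp
  have h : ((m * ((k + 1) ^ m * (k + 2)) : ℕ) : ℝ≥0) ≤
      2 * ((k + 1 : ℝ≥0) ^ m * (ρ * (3 * n : ℕ))) := by
    exact_mod_cast hlow.trans (mul_le_mul_right hup 2)
  have hpos : (0 : ℝ≥0) < (k + 1 : ℝ≥0) ^ m := by positivity
  refine le_of_mul_le_mul_left ?_ hpos
  push_cast at h
  calc _ = (m : ℝ≥0) * ((k + 1) ^ m * (k + 2)) := by ring
    _ ≤ _ := h
    _ = _ := by ring

theorem le_ratio_of_isCompetitive {R : RandAlg n} {ρ : ℝ≥0} (hn : 3 ≤ n)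
    (hR : R.IsCompetitive ρ) : (n : ℝ≥0) ≤ 90 * ρ := by
  -- The worst case of `n ≤ 5 * m` is `n = 5`, `m = 1`. The final constant is `90 = 15 * 6`.
  obtain ⟨m, k, hmk, hm, hk⟩ : ∃ m k, m + (m + (k + 1)) = n ∧ n ≤ 5 * m ∧ n ≤ 3 * (k + 2) :=
    ⟨n / 3, n - 2 * (n / 3) - 1, by omega, by omega, by omega⟩
  have e : Label m k ≃ Fin n := Fintype.equivFinOfCardEq (by simp [hmk])
  have h := mul_le_of_isCompetitive e hR
  have h' : (n * n : ℝ≥0) ≤ 15 * (m * (k + 2)) := by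
    have : n * n ≤ 15 * (m * (k + 2)) := by nlinarith
    exact_mod_cast this
  have hpos : (0 : ℝ≥0) < n := by exact_mod_cast (by omega : 0 < n)
  refine le_of_mul_le_mul_left ?_ hpos
  calc (n * n : ℝ≥0) ≤ 15 * (m * (k + 2)) := h'
    _ ≤ 15 * (6 * n * ρ) := by gcongr
    _ = n * (90 * ρ) := by ring

/-! ### The best possible ratios -/

theorem bestDetRatio_le (n : ℕ) : bestDetRatio n ≤ ((4 * n : ℝ≥0) : ℝ≥0∞) :=
  iInf₂_le (4 * n : ℝ≥0) (exists_detAlg_isCompetitive n)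

theorem bestRandRatio_le_bestDetRatio (n : ℕ) : bestRandRatio n ≤ bestDetRatio n := by
  refine le_iInf₂ fun ρ ⟨D, hD⟩ => iInf₂_le ρ ⟨fun PA => PMF.pure (D PA), ?_, ?_⟩
  · intro PA S hS
    rw [PMF.support_pure, Set.mem_singleton_iff] at hS
    exact hS ▸ hD.1 PA
  · intro PA PB
    have : RandAlg.expectedCost (fun PA => PMF.pure (D PA)) PA PB = (D PA).cost PB ∅ := by
      rw [RandAlg.expectedCost, tsum_eq_single (D PA)]
      · simp
      · intro S hS
        simp [PMF.pure_apply, hS]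
    rw [this]
    exact_mod_cast hD.2 PA PB

theorem le_bestRandRatio {n : ℕ} (hn : 3 ≤ n) : (n : ℝ≥0∞) ≤ 90 * bestRandRatio n := by
  rw [mul_comm, ← ENNReal.div_le_iff (by norm_num) (by norm_num)]
  refine le_iInf₂ fun ρ ⟨R, hR⟩ => ?_
  rw [ENNReal.div_le_iff (by norm_num) (by norm_num), mul_comm]
  exact_mod_cast le_ratio_of_isCompetitive hn hR

theorem isTheta_of_bounds {F : ℕ → ℝ≥0∞} (hup : ∀ n : ℕ, F n ≤ ((4 * n : ℝ≥0) : ℝ≥0∞))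
    (hlow : ∀ n : ℕ, 3 ≤ n → (n : ℝ≥0∞) ≤ 90 * F n) :
    (∀ n, F n ≠ ⊤) ∧ Asymptotics.IsTheta Filter.atTop
      (fun n : ℕ => (F n).toReal) (fun n : ℕ => (n : ℝ)) := by
  have hfin : ∀ n, F n ≠ ⊤ := fun n => ne_top_of_le_ne_top ENNReal.coe_ne_top (hup n)
  refine ⟨hfin, Asymptotics.IsBigO.of_bound 4 (Filter.Eventually.of_forall fun n => ?_),
    Asymptotics.IsBigO.of_bound 90 (Filter.eventually_atTop.mpr ⟨3, fun n hn => ?_⟩)⟩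
  · have := ENNReal.toReal_mono ENNReal.coe_ne_top (hup n)
    simpa using this
  · have := ENNReal.toReal_mono (ENNReal.mul_ne_top (by norm_num) (hfin n)) (hlow n hn)
    simpa using this

end Interview

theorem mainTheorem7 :
    ((∀ n : ℕ, Interview.bestRandRatio n ≠ ⊤) ∧
      Asymptotics.IsTheta Filter.atTop
        (fun n : ℕ => (Interview.bestRandRatio n).toReal) (fun n : ℕ => (n : ℝ))) ∧
    ((∀ n : ℕ, Interview.bestDetRatio n ≠ ⊤) ∧
      Asymptotics.IsTheta Filter.atTop
        (fun n : ℕ => (Interview.bestDetRatio n).toReal) (fun n : ℕ => (n : ℝ))) := by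
  refine ⟨Interview.isTheta_of_bounds (fun n => ?_) fun n hn => Interview.le_bestRandRatio hn,
    Interview.isTheta_of_bounds Interview.bestDetRatio_le fun n hn => ?_⟩
  · exact (Interview.bestRandRatio_le_bestDetRatio n).trans (Interview.bestDetRatio_le n)
  · exact (Interview.le_bestRandRatio hn).trans
      (mul_le_mul_right (Interview.bestRandRatio_le_bestDetRatio n) 90)
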